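/- Let $m\ge 1$ be an integer. For a real algebraic number $\alpha$, let its height $H(\alpha)$ be the maximum of the absolute values of the coefficients of its minimal polynomial over $\mathbb{Z}$. For $\xi\in\mathbb{R}$ and $n\ge 1$, let $\omega_n^*(\xi)\in[0,\infty]$ be the supremum of the positive real numbers $\omega^*$ for which there are infinitely many real algebraic numbers $\alpha$ of degree $n$ with $$0<|\xi-\alpha|<H(\alpha)^{-\omega^*-1}.$$ The number $\xi$ is called a $U_m$-number if $\omega_m^*(\xi)=\infty$ and $\omega_n^*(\xi)<\infty$ for all $1\le n<m$. Let $\ell=\sum_{n\ge 1}10^{-n!}$ be the Liouville constant. Then the following hold. (i) There are infinitely many $U_m$-numbers $\xi$ such that for every positive divisor $d$ of $m$ there is an integer $k\ge 1$ for which $\xi^k$ is a $U_d$-number. In particular, for every prime number $p$, the number $\xi=\sqrt[m]{p}\cdot\ell$ has this property. (ii) There are infinitely many $U_m$-numbers $\xi$ such that $\xi^k$ is a $U_m$-number for all integers $k\ge 1$. In particular, for every prime number $p$, the number $\xi=(1+\sqrt[m]{p})\cdot\ell$ has this property. -/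

import Mathlib

open Polynomial
open scoped ENNReal

/-- The minimal polynomial over `ℤ` (up to sign) of an algebraic real number `α`: clear the
denominators of its minimal polynomial over `ℚ`, then divide by the gcd of the coefficients.
(`minpoly ℤ α` would be `0` unless `α` is an algebraic integer.) -/
noncomputable def intMinpoly (α : ℝ) : ℤ[X] :=
  (IsLocalization.integerNormalization (nonZeroDivisors ℤ) (minpoly ℚ α)).primPart

/-- The height of an algebraic real number: the maximum of the absolute values of the
coefficients of its minimal polynomial over `ℤ`. -/
noncomputable def algHeight (α : ℝ) : ℝ :=
  (intMinpoly α).supNorm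

/-- The real algebraic numbers `α` of degree exactly `n` with
`0 < |ξ - α| < H(α) ^ (-w - 1)`. -/
def algApprox (n : ℕ) (ξ w : ℝ) : Set ℝ :=
  {α : ℝ | IsAlgebraic ℚ α ∧ (minpoly ℚ α).natDegree = n ∧
    0 < |ξ - α| ∧ |ξ - α| < algHeight α ^ (-w - 1)}

/-- `ω*_n(ξ)`, the supremum in `[0, ∞]` of the positive real numbers `w` for which infinitely many
real algebraic numbers `α` of degree `n` satisfy `0 < |ξ - α| < H(α) ^ (-w - 1)`. -/
noncomputable def omegaStar (n : ℕ) (ξ : ℝ) : ℝ≥0∞ :=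
  sSup (ENNReal.ofReal '' {w : ℝ | 0 < w ∧ (algApprox n ξ w).Infinite})

/-- `ξ` is a `U_m`-number: `ω*_m(ξ) = ∞` and `ω*_n(ξ) < ∞` for all `1 ≤ n < m`. -/
def IsUNumber (m : ℕ) (ξ : ℝ) : Prop :=
  1 ≤ m ∧ omegaStar m ξ = ∞ ∧ ∀ n : ℕ, 1 ≤ n → n < m → omegaStar n ξ < ∞

/-- The Liouville constant `∑_{n ≥ 1} 10 ^ (-n!)`. -/
noncomputable def liouvilleConst : ℝ :=
  ∑' n : ℕ, (1 / 10 : ℝ) ^ (n + 1).factorial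

/-! Everything rests on one fact, `isUNumber_mul_liouvilleConst_pow`: if β > 0 is an algebraic
integer of degree d and k ≥ 1, then βℓ^k is a U_d-number. Truncating ℓ gives p/q with q = 10^(N!)
and 0 < ℓ^k - (p/q)^k ≤ k/q^N. The numbers β(p/q)^k have degree d and height at most H(β)q^(kd), so
ω*_d = ∞.

For α of degree less than d, rescaling its minimal polynomial by (p/q)^k gives a nonzero integer
polynomial of degree less than d. Its value at β has nonzero integer norm, so |β(p/q)^k - α| is at
least a constant times a negative power of H(α)q^(kd). A suitable q, polynomially bounded in H(α),
makes the truncation error negligible and transfers the bound to βℓ^k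
(`exists_le_mul_pow_of_forall_factorial`).

For (i), if m = dk then the k-th power of p^(1/m)ℓ is p^(1/d)ℓ^k. For (ii), (1 + p^(1/m))^k still
has degree m (`adjoin_one_add_pow_eq`). Distinct primes give distinct numbers. -/

/-! ### Integer minimal polynomials and heights. -/

theorem Polynomial.supNorm_le_of_forall_coeff {P : ℤ[X]} {B : ℝ}
    (h : ∀ i, |(P.coeff i : ℝ)| ≤ B) : P.supNorm ≤ B := by
  obtain ⟨i, hi⟩ := P.exists_eq_supNorm
  rw [hi, Int.norm_eq_abs]
  exact h i

theorem Polynomial.abs_coeff_le_supNorm (P : ℤ[X]) (i : ℕ) : |(P.coeff i : ℝ)| ≤ P.supNorm := by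
  rw [← Int.norm_eq_abs]
  exact P.le_supNorm i

theorem Polynomial.one_le_supNorm {P : ℤ[X]} (hP : P ≠ 0) : 1 ≤ P.supNorm := by
  refine le_trans ?_ (P.abs_coeff_le_supNorm P.natDegree)
  rw [coeff_natDegree]
  exact_mod_cast Int.one_le_abs (leadingCoeff_ne_zero.mpr hP)

theorem intNormalization_minpoly_ne_zero {α : ℝ} (hα : IsAlgebraic ℚ α) :
    IsLocalization.integerNormalization (nonZeroDivisors ℤ) (minpoly ℚ α) ≠ 0 := by
  rw [Ne, IsLocalization.integerNormalization_eq_zero_iff le_rfl]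
  exact minpoly.ne_zero hα.isIntegral

theorem intMinpoly_ne_zero (α : ℝ) : intMinpoly α ≠ 0 :=
  (isPrimitive_primPart _).ne_zero

theorem aeval_intMinpoly {α : ℝ} (hα : IsAlgebraic ℚ α) : aeval α (intMinpoly α) = 0 :=
  aeval_primPart_eq_zero (intNormalization_minpoly_ne_zero hα)
    (IsLocalization.integerNormalization_aeval_eq_zero _ _ (minpoly.aeval ℚ α))

theorem natDegree_intMinpoly (α : ℝ) : (intMinpoly α).natDegree = (minpoly ℚ α).natDegree := by
  obtain ⟨b, hb, h⟩ :=
    IsLocalization.integerNormalization_spec (nonZeroDivisors ℤ) (minpoly ℚ α)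
  rw [intMinpoly, natDegree_primPart,
    ← natDegree_map_eq_of_injective (algebraMap ℤ ℚ).injective_int, h]
  exact natDegree_smul _ (nonZeroDivisors.ne_zero hb)

/-- Gauss's lemma: divisibility over ℚ by a primitive polynomial descends to ℤ. -/
theorem intMinpoly_dvd {α : ℝ} {P : ℤ[X]} (hP : aeval α P = 0) : intMinpoly α ∣ P := by
  refine (isPrimitive_primPart _).dvd_of_fraction_map_dvd_fraction_map (K := ℚ) ?_
  refine (Polynomial.map_dvd _ (primPart_dvd _)).trans ?_
  obtain ⟨b, hb, h⟩ :=
    IsLocalization.integerNormalization_spec (nonZeroDivisors ℤ) (minpoly ℚ α)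
  have hb0 : (b : ℚ) ≠ 0 := by exact_mod_cast nonZeroDivisors.ne_zero hb
  rw [h]
  obtain ⟨r, hr⟩ := minpoly.dvd ℚ α (p := P.map (algebraMap ℤ ℚ)) (by rwa [aeval_map_algebraMap])
  refine ⟨C (b : ℚ)⁻¹ * r, ?_⟩
  rw [hr, zsmul_eq_mul, ← Polynomial.C_eq_intCast]
  calc minpoly ℚ α * r = C ((b : ℚ) * (b : ℚ)⁻¹) * (minpoly ℚ α * r) := by
        rw [mul_inv_cancel₀ hb0]; simp
    _ = _ := by rw [C_mul]; simp; ring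

theorem one_le_algHeight (α : ℝ) : 1 ≤ algHeight α :=
  Polynomial.one_le_supNorm (intMinpoly_ne_zero α)

/-- By degree, the cofactor of `intMinpoly α` in `P` is a nonzero integer constant, which cannot
shrink coefficients. -/
theorem algHeight_le_supNorm {α : ℝ} {P : ℤ[X]} (hP : P ≠ 0)
    (hroot : aeval α P = 0) (hdeg : P.natDegree = (minpoly ℚ α).natDegree) :
    algHeight α ≤ P.supNorm := by
  obtain ⟨R, rfl⟩ := intMinpoly_dvd hroot
  have hR : R ≠ 0 := right_ne_zero_of_mul hP
  rw [natDegree_mul (intMinpoly_ne_zero α) hR, natDegree_intMinpoly] at hdeg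
  obtain ⟨c, rfl⟩ := natDegree_eq_zero.mp (show R.natDegree = 0 by omega)
  have hc : c ≠ 0 := by rintro rfl; simp at hR
  refine Polynomial.supNorm_le_of_forall_coeff fun i => ?_
  refine le_trans ?_ (Polynomial.abs_coeff_le_supNorm _ i)
  rw [coeff_mul_C]
  push_cast
  rw [abs_mul]
  exact le_mul_of_one_le_right (abs_nonneg _) (by exact_mod_cast Int.one_le_abs hc)

/-- Northcott: finitely many integer polynomials have bounded degree and coefficients, and each has
finitely many roots. -/
theorem finite_algHeight_le (n : ℕ) (B : ℝ) :
    {α : ℝ | IsAlgebraic ℚ α ∧ (minpoly ℚ α).natDegree = n ∧ algHeight α ≤ B}.Finite := by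
  classical
  refine (bUnion_roots_finite (algebraMap ℤ ℝ) n (Set.finite_Icc (-⌊B⌋) ⌊B⌋)).subset ?_
  rintro α ⟨hα, hn, hB⟩
  simp only [Set.mem_iUnion]
  refine ⟨intMinpoly α, ⟨(natDegree_intMinpoly α).trans hn |>.le, fun i => ?_⟩, ?_⟩
  · rw [Set.mem_Icc, ← abs_le, Int.le_floor]
    push_cast
    exact (Polynomial.abs_coeff_le_supNorm _ i).trans hB
  · simp only [Finset.mem_coe, Multiset.mem_toFinset]
    rw [mem_roots (by
      rw [Ne, Polynomial.map_eq_zero_iff (algebraMap ℤ ℝ).injective_int]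
      exact intMinpoly_ne_zero α), IsRoot, eval_map_algebraMap]
    exact aeval_intMinpoly hα

/-! ### Upper and lower bounds for values of integer polynomials. -/

theorem Polynomial.norm_aeval_le_supNorm {A : Type*} [NormedField A] [CharZero A] [NormedAlgebra ℝ A]
    (P : ℤ[X]) {d : ℕ} (hd : P.natDegree < d) {z : A} {M : ℝ} (hM : 1 ≤ M) (hz : ‖z‖ ≤ M) :
    ‖aeval z P‖ ≤ d * P.supNorm * M ^ d := by
  rw [aeval_eq_sum_range' hd, mul_assoc, ← nsmul_eq_mul]
  refine (norm_sum_le_of_le _ (f := fun i => P.coeff i • z ^ i)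
    (n := fun _ => P.supNorm * M ^ d) fun i hi => ?_).trans (by simp)
  rw [zsmul_eq_mul, norm_mul, norm_pow]
  have h1 : ‖(P.coeff i : A)‖ = |(P.coeff i : ℝ)| := by
    have : (P.coeff i : A) = algebraMap ℝ A (P.coeff i) := by simp
    rw [this, norm_algebraMap']; rfl
  rw [h1]
  have h2 : ‖z‖ ^ i ≤ M ^ d := (pow_le_pow_left₀ (norm_nonneg _) hz i).trans
    (pow_le_pow_right₀ hM (Finset.mem_range.mp hi).le)
  exact mul_le_mul (P.abs_coeff_le_supNorm i) h2 (by positivity) P.supNorm_nonneg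

theorem Polynomial.abs_aeval_sub_aeval_le (P : ℤ[X]) {d : ℕ} (hd : P.natDegree < d)
    {x y M : ℝ} (hM : 1 ≤ M) (hx : |x| ≤ M) (hy : |y| ≤ M) :
    |aeval x P - aeval y P| ≤ d * (d * P.supNorm * M ^ d) * |x - y| := by
  rw [aeval_eq_sum_range' hd, aeval_eq_sum_range' hd, ← Finset.sum_sub_distrib]
  refine (Finset.abs_sum_le_sum_abs _ _).trans ?_
  refine (Finset.sum_le_card_nsmul _ _ (d * P.supNorm * M ^ d * |x - y|) fun i hi => ?_).trans
    (le_of_eq (by simp; ring))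
  have hid := Finset.mem_range.mp hi
  rw [zsmul_eq_mul, zsmul_eq_mul, ← mul_sub, abs_mul]
  have h1 : |x ^ i - y ^ i| ≤ |x - y| * d * M ^ d := by
    refine (abs_pow_sub_pow_le x y i).trans ?_
    have h3 : max |x| |y| ^ (i - 1) ≤ M ^ d :=
      (pow_le_pow_left₀ (by positivity) (max_le hx hy) _).trans (pow_le_pow_right₀ hM (by omega))
    gcongr
  calc |(P.coeff i : ℝ)| * |x ^ i - y ^ i| ≤ P.supNorm * (|x - y| * d * M ^ d) :=
        mul_le_mul (P.abs_coeff_le_supNorm i) h1 (abs_nonneg _) P.supNorm_nonneg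
    _ = _ := by ring

theorem aeval_int_ne_zero_of_natDegree_lt {β : ℝ} {P : ℤ[X]} (hP : P ≠ 0)
    (hd : P.natDegree < (minpoly ℚ β).natDegree) : aeval β P ≠ 0 := by
  intro h
  have := natDegree_le_of_dvd (intMinpoly_dvd h) hP
  rw [natDegree_intMinpoly] at this
  omega

open IntermediateField in
/-- A Liouville-type lower bound for the values of integer polynomials of small degree at a fixed
algebraic integer, obtained from the norm. -/
theorem exists_le_abs_aeval_mul_supNorm_pow {β : ℝ} (hβ : IsIntegral ℤ β) :
    ∃ c : ℝ, 0 < c ∧ ∀ P : ℤ[X], P ≠ 0 → P.natDegree < (minpoly ℚ β).natDegree →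
      c ≤ |aeval β P| * P.supNorm ^ ((minpoly ℚ β).natDegree - 1) := by
  classical
  have hβQ : IsIntegral ℚ β := hβ.tower_top
  set d := (minpoly ℚ β).natDegree with hd
  have hd0 : 0 < d := minpoly.natDegree_pos hβQ
  have : FiniteDimensional ℚ ℚ⟮β⟯ := adjoin.finiteDimensional hβQ
  have hcard : Fintype.card (ℚ⟮β⟯ →ₐ[ℚ] ℂ) = d := by
    rw [AlgHom.card, adjoin.finrank hβQ]
  let g : ℚ⟮β⟯ := AdjoinSimple.gen ℚ β
  have hg : algebraMap ℚ⟮β⟯ ℝ g = β := AdjoinSimple.algebraMap_gen ℚ β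
  have hgint : IsIntegral ℤ g := by
    rw [← isIntegral_algebraMap_iff (algebraMap ℚ⟮β⟯ ℝ).injective, hg]
    exact hβ
  -- A bound for all conjugates of β at once, independent of `P`.
  let M : ℝ := 1 + ∑ σ : ℚ⟮β⟯ →ₐ[ℚ] ℂ, ‖σ g‖
  have hM : 1 ≤ M := le_add_of_nonneg_right (Finset.sum_nonneg fun _ _ => norm_nonneg _)
  have hσM (σ : ℚ⟮β⟯ →ₐ[ℚ] ℂ) : ‖σ g‖ ≤ M :=
    (Finset.single_le_sum (f := fun σ : ℚ⟮β⟯ →ₐ[ℚ] ℂ => ‖σ g‖) (fun _ _ => norm_nonneg _)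
      (Finset.mem_univ σ)).trans (by simp [M])
  let σ₀ : ℚ⟮β⟯ →ₐ[ℚ] ℂ := (Complex.ofRealAm.restrictScalars ℚ).comp (ℚ⟮β⟯).val
  refine ⟨((d * M ^ d) ^ (d - 1))⁻¹, by positivity, fun P hP hPd => ?_⟩
  let x : ℚ⟮β⟯ := aeval g P
  have hx : algebraMap ℚ⟮β⟯ ℝ x = aeval β P := by
    rw [← aeval_algebraMap_apply, hg]
  have hx0 : x ≠ 0 := by
    intro h
    apply aeval_int_ne_zero_of_natDegree_lt hP hPd
    rw [← hx, h, map_zero]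
  have hxint : IsIntegral ℤ x := IsIntegral.of_mem_of_fg (Algebra.adjoin ℤ {g})
    hgint.fg_adjoin_singleton _ (aeval_mem_adjoin_singleton ℤ g)
  obtain ⟨N, hN⟩ := IsIntegrallyClosed.isIntegral_iff.mp (Algebra.isIntegral_norm ℚ hxint)
  have hN0 : N ≠ 0 := by
    rintro rfl
    exact Algebra.norm_ne_zero_iff.mpr hx0 (by rw [← hN]; simp)
  have hprod := Algebra.norm_eq_prod_embeddings ℚ ℂ x
  rw [← hN] at hprod
  -- The norm is a nonzero integer. The factor at σ₀ is |P(β)|; the other d - 1 are bounded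
  -- trivially.
  have hone : (1 : ℝ) ≤ ∏ σ : ℚ⟮β⟯ →ₐ[ℚ] ℂ, ‖σ x‖ := by
    rw [← norm_prod, ← hprod]
    simp only [algebraMap_int_eq, eq_intCast, eq_ratCast, Rat.cast_intCast, Complex.norm_intCast]
    exact_mod_cast Int.one_le_abs hN0
  have hσ₀ : ‖σ₀ x‖ = |aeval β P| := by
    rw [← hx]
    exact Complex.norm_real _
  have hother : ∏ σ ∈ Finset.univ.erase σ₀, ‖σ x‖ ≤ (d * P.supNorm * M ^ d) ^ (d - 1) := by
    refine (Finset.prod_le_prod (g := fun _ => d * P.supNorm * M ^ d)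
      (fun _ _ => norm_nonneg _) fun σ _ => ?_).trans (le_of_eq ?_)
    · have : σ x = aeval (σ g) P := by
        rw [show x = aeval g P from rfl]
        exact (Polynomial.aeval_algHom_apply (σ.restrictScalars ℤ) g P).symm
      rw [this]
      exact P.norm_aeval_le_supNorm hPd hM (hσM σ)
    · rw [Finset.prod_const, Finset.card_erase_of_mem (Finset.mem_univ _), Finset.card_univ, hcard]
  rw [← Finset.mul_prod_erase _ _ (Finset.mem_univ σ₀), hσ₀] at hone
  rw [inv_le_iff_one_le_mul₀ (by positivity)]
  refine hone.trans ((mul_le_mul_of_nonneg_left hother (abs_nonneg _)).trans (le_of_eq ?_))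
  rw [mul_assoc |aeval β P|, ← mul_pow]
  ring_nf

/-! ### Rational multiples of an algebraic number. -/

open IntermediateField in
theorem natDegree_minpoly_mul_ratCast {β : ℝ} (hβ : IsIntegral ℚ β) {r : ℚ} (hr : r ≠ 0) :
    (minpoly ℚ (β * r)).natDegree = (minpoly ℚ β).natDegree := by
  have hr' : IsIntegral ℚ (β * (r : ℝ)) := hβ.mul (isIntegral_algebraMap (R := ℚ) (x := r))
  rw [← adjoin.finrank hβ, ← adjoin.finrank hr']
  have h0 : (r : ℝ) ≠ 0 := by exact_mod_cast hr
  have hrat (K : IntermediateField ℚ ℝ) : (r : ℝ) ∈ K := K.algebraMap_mem r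
  have : ℚ⟮β * (r : ℝ)⟯ = ℚ⟮β⟯ := by
    apply le_antisymm
    · exact adjoin_simple_le_iff.mpr (mul_mem (mem_adjoin_simple_self ℚ β) (hrat _))
    · refine adjoin_simple_le_iff.mpr ?_
      have := div_mem (mem_adjoin_simple_self ℚ (β * (r : ℝ))) (hrat ℚ⟮β * (r : ℝ)⟯)
      rwa [mul_div_cancel_right₀ _ h0] at this
  rw [this]

/-- The homogenized rescaling `b ^ n * P (a * X / b)` of a polynomial `P` of degree `n`. -/
noncomputable def Polynomial.rescale (P : ℤ[X]) (a b : ℤ) : ℤ[X] :=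
  (P.scaleRoots b).comp (C a * X)

theorem Polynomial.coeff_rescale (P : ℤ[X]) (a b : ℤ) (i : ℕ) :
    (P.rescale a b).coeff i = P.coeff i * b ^ (P.natDegree - i) * a ^ i := by
  rw [rescale, comp_C_mul_X_coeff, coeff_scaleRoots]

theorem Polynomial.aeval_rescale (P : ℤ[X]) (a : ℤ) {b : ℤ} (hb : b ≠ 0) (x : ℝ) :
    aeval x (P.rescale a b) = b ^ P.natDegree * aeval (x * (a / b)) P := by
  have hb' : (b : ℝ) ≠ 0 := by exact_mod_cast hb
  rw [rescale, aeval_comp]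
  have : aeval x (C a * X : ℤ[X]) = algebraMap ℤ ℝ b * (x * (a / b)) := by
    simp; field_simp
  rw [this, aeval_def, scaleRoots_eval₂_mul]
  simp [aeval_def]

theorem Polynomial.natDegree_rescale (P : ℤ[X]) {a : ℤ} (ha : a ≠ 0) (b : ℤ) :
    (P.rescale a b).natDegree = P.natDegree := by
  rw [rescale, natDegree_comp, natDegree_scaleRoots, natDegree_C_mul_X _ ha, mul_one]

theorem Polynomial.rescale_ne_zero {P : ℤ[X]} (hP : P ≠ 0) {a : ℤ} (ha : a ≠ 0) (b : ℤ) :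
    P.rescale a b ≠ 0 := by
  intro h
  have := congrArg (fun Q => Q.coeff P.natDegree) h
  simp [coeff_rescale, hP, ha] at this

theorem Polynomial.supNorm_rescale_le (P : ℤ[X]) {a b : ℤ} {c : ℝ} (ha : |(a : ℝ)| ≤ c)
    (hb : |(b : ℝ)| ≤ c) : (P.rescale a b).supNorm ≤ P.supNorm * c ^ P.natDegree := by
  have hc : 0 ≤ c := (abs_nonneg _).trans ha
  refine supNorm_le_of_forall_coeff fun i => ?_
  rw [coeff_rescale]
  by_cases hi : i ≤ P.natDegree
  · push_cast
    rw [abs_mul, abs_mul, abs_pow, abs_pow, mul_assoc]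
    have : |(b : ℝ)| ^ (P.natDegree - i) * |(a : ℝ)| ^ i ≤ c ^ P.natDegree := by
      calc _ ≤ c ^ (P.natDegree - i) * c ^ i := by gcongr
        _ = _ := by rw [← pow_add, Nat.sub_add_cancel hi]
    exact mul_le_mul (P.abs_coeff_le_supNorm i) this (by positivity) P.supNorm_nonneg
  · rw [coeff_eq_zero_of_natDegree_lt (not_le.mp hi)]
    simpa using mul_nonneg P.supNorm_nonneg (pow_nonneg hc _)

theorem algHeight_mul_div_le {β : ℝ} (hβ : IsAlgebraic ℚ β) {a b : ℤ} (ha : 0 < a) (hab : a ≤ b) :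
    algHeight (β * (a / b)) ≤ algHeight β * (b : ℝ) ^ (minpoly ℚ β).natDegree := by
  have hb : 0 < b := ha.trans_le hab
  have ha' : (0 : ℝ) < a := by exact_mod_cast ha
  have hb' : (0 : ℝ) < b := by exact_mod_cast hb
  have hab' : (a : ℝ) ≤ b := by exact_mod_cast hab
  have hdeg := natDegree_minpoly_mul_ratCast hβ.isIntegral (r := (a / b : ℚ)) (by positivity)
  push_cast at hdeg
  -- The arguments are swapped because a^n P(bX/a) is what vanishes at βa/b.
  refine (algHeight_le_supNorm (P := (intMinpoly β).rescale b a)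
    (rescale_ne_zero (intMinpoly_ne_zero β) hb.ne' a) ?_ ?_).trans ?_
  · rw [aeval_rescale _ _ ha.ne', mul_assoc β, div_mul_div_cancel₀ hb'.ne', div_self ha'.ne',
      mul_one, aeval_intMinpoly hβ, mul_zero]
  · rw [natDegree_rescale _ hb.ne', natDegree_intMinpoly, hdeg]
  · rw [← natDegree_intMinpoly]
    exact supNorm_rescale_le _ (abs_of_pos hb').le (by rwa [abs_of_pos ha'])

/-- Rational multiples of a fixed algebraic integer `β` keep away from algebraic numbers of degree
smaller than that of `β`. -/
theorem exists_le_abs_mul_div_sub {β : ℝ} (hβ : IsIntegral ℤ β) {M : ℝ} (hM : 1 ≤ M) :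
    ∃ c : ℝ, 0 < c ∧ ∀ (α : ℝ) (a b : ℤ), IsAlgebraic ℚ α →
      (minpoly ℚ α).natDegree < (minpoly ℚ β).natDegree → |α| ≤ M → 0 < a → a ≤ b →
      |β * (a / b)| ≤ M →
      c ≤ |β * (a / b) - α| * (algHeight α * (b : ℝ) ^ (minpoly ℚ β).natDegree) ^
        (minpoly ℚ β).natDegree := by
  obtain ⟨c, hc, hlow⟩ := exists_le_abs_aeval_mul_supNorm_pow hβ
  set d := (minpoly ℚ β).natDegree with hd
  have hd0 : 0 < d := minpoly.natDegree_pos hβ.tower_top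
  refine ⟨c / (d * (d * M ^ d)), by positivity, fun α a b hα hn hαM ha hab hβM => ?_⟩
  have hb : 0 < b := ha.trans_le hab
  have ha' : (0 : ℝ) < a := by exact_mod_cast ha
  have hb1 : (1 : ℝ) ≤ b := by exact_mod_cast hb
  have hab' : (a : ℝ) ≤ b := by exact_mod_cast hab
  have hH : 1 ≤ algHeight α := one_le_algHeight α
  obtain ⟨P, hP⟩ : ∃ P, P = intMinpoly α := ⟨_, rfl⟩
  have hP0 : P ≠ 0 := hP ▸ intMinpoly_ne_zero α
  have hPα : aeval α P = 0 := hP ▸ aeval_intMinpoly hα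
  have hPH : P.supNorm = algHeight α := by rw [hP, algHeight]
  have hPn : P.natDegree < d := by rwa [hP, natDegree_intMinpoly]
  clear_value d
  have hnorm : (P.rescale a b).supNorm ≤ algHeight α * (b : ℝ) ^ d := by
    refine (P.supNorm_rescale_le (c := b) (by rwa [abs_of_pos ha'])
      (abs_of_nonneg (by positivity)).le).trans ?_
    rw [hPH]
    exact mul_le_mul_of_nonneg_left (pow_le_pow_right₀ hb1 hPn.le) (by positivity)
  have hval : |aeval β (P.rescale a b)| ≤
      d * (d * M ^ d) * |β * (a / b) - α| * (algHeight α * (b : ℝ) ^ d) := by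
    rw [P.aeval_rescale a hb.ne', abs_mul, abs_of_nonneg (by positivity)]
    have h := P.abs_aeval_sub_aeval_le hPn hM hβM hαM
    rw [hPα, sub_zero, hPH] at h
    calc _ ≤ (b : ℝ) ^ d * (d * (d * algHeight α * M ^ d) * |β * (a / b) - α|) :=
          mul_le_mul (pow_le_pow_right₀ hb1 hPn.le) h (abs_nonneg _) (by positivity)
      _ = _ := by ring
  have h := hlow (P.rescale a b) (rescale_ne_zero hP0 ha.ne' b)
    (by rwa [natDegree_rescale _ ha.ne'])
  rw [div_le_iff₀ (by positivity)]
  calc c ≤ _ := h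
    _ ≤ d * (d * M ^ d) * |β * (a / b) - α| * (algHeight α * (b : ℝ) ^ d) *
        (algHeight α * (b : ℝ) ^ d) ^ (d - 1) :=
      mul_le_mul hval (pow_le_pow_left₀ (supNorm_nonneg _) hnorm _)
        (pow_nonneg (supNorm_nonneg _) _) ((abs_nonneg _).trans hval)
    _ = d * (d * M ^ d) * |β * (a / b) - α| * ((algHeight α * (b : ℝ) ^ d) ^ (d - 1) *
        (algHeight α * (b : ℝ) ^ d)) := by ring
    -- The norm bound contributes d - 1 factors, and the mean-value estimate `hval` the last one.
    _ = _ := by rw [← pow_succ, Nat.sub_add_cancel hd0]; ring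

/-! ### Truncations of the Liouville constant. -/

/-- The series `liouvilleNumber` starts at n = 0, whence the extra term 10^(-0!) = 1/10. -/
theorem liouvilleConst_eq : liouvilleConst = liouvilleNumber 10 - 1 / 10 := by
  rw [liouvilleNumber, (LiouvilleNumber.summable (by norm_num : (1 : ℝ) < 10)).tsum_eq_zero_add]
  simp [liouvilleConst]

theorem liouvilleConst_sub_partialSum (N : ℕ) :
    liouvilleConst - (LiouvilleNumber.partialSum 10 N - 1 / 10) = LiouvilleNumber.remainder 10 N := by
  rw [liouvilleConst_eq,
    ← LiouvilleNumber.partialSum_add_remainder (by norm_num : (1 : ℝ) < 10) N]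
  ring

theorem liouvilleConst_le_one : liouvilleConst ≤ 1 := by
  have h1 := liouvilleConst_sub_partialSum 1
  have h2 := LiouvilleNumber.remainder_lt 1 (by norm_num : (2 : ℝ) ≤ 10)
  norm_num [LiouvilleNumber.partialSum, Finset.sum_range_succ] at h1 h2
  linarith

theorem exists_liouvilleConst_approx (N : ℕ) (hN : 1 ≤ N) :
    ∃ p : ℤ, 0 < p ∧ p ≤ 10 ^ N.factorial ∧
      0 < liouvilleConst - p / 10 ^ N.factorial ∧
      liouvilleConst - p / 10 ^ N.factorial ≤ 1 / ((10 : ℝ) ^ N.factorial) ^ N := by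
  obtain ⟨r, hr⟩ := LiouvilleNumber.partialSum_eq_rat (m := 10) (by norm_num) N
  push_cast at hr
  have hq : (0 : ℝ) < 10 ^ N.factorial := by positivity
  have hval : (((r : ℤ) - 10 ^ (N.factorial - 1) : ℤ) : ℝ) / 10 ^ N.factorial =
      LiouvilleNumber.partialSum 10 N - 1 / 10 := by
    rw [hr]
    have : (10 : ℝ) ^ N.factorial = 10 ^ (N.factorial - 1) * 10 := by
      rw [← pow_succ, Nat.sub_add_cancel N.factorial_pos]
    push_cast
    rw [sub_div]
    congr 1
    rw [this]
    field_simp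
  have hrem := liouvilleConst_sub_partialSum N
  have hpos := LiouvilleNumber.remainder_pos (by norm_num : (1 : ℝ) < 10) N
  have hlt := LiouvilleNumber.remainder_lt N (by norm_num : (2 : ℝ) ≤ 10)
  refine ⟨r - 10 ^ (N.factorial - 1), ?_, ?_, ?_, ?_⟩
  -- The terms n = 0 and n = 1 are both 1/10, so positivity survives subtracting one of them.
  · have h2 : (2 / 10 : ℝ) ≤ LiouvilleNumber.partialSum 10 N := by
      have := Finset.sum_le_sum_of_subset_of_nonneg (f := fun i : ℕ => 1 / (10 : ℝ) ^ i.factorial)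
        (Finset.range_mono (show 2 ≤ N + 1 by omega)) (fun _ _ _ => by positivity)
      rw [LiouvilleNumber.partialSum]
      refine le_trans ?_ this
      norm_num [Finset.sum_range_succ]
    have h3 : (0 : ℝ) < (((r : ℤ) - 10 ^ (N.factorial - 1) : ℤ) : ℝ) / 10 ^ N.factorial := by
      rw [hval]; linarith
    exact_mod_cast (div_pos_iff_of_pos_right hq).mp h3
  · have h3 : (((r : ℤ) - 10 ^ (N.factorial - 1) : ℤ) : ℝ) / 10 ^ N.factorial ≤ 1 := by
      rw [hval]; linarith [liouvilleConst_le_one]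
    rw [div_le_one hq] at h3
    exact_mod_cast h3
  · rwa [hval, hrem]
  · rw [hval, hrem]
    exact hlt.le

theorem liouvilleConst_pos : 0 < liouvilleConst := by
  obtain ⟨p, hp, -, h, -⟩ := exists_liouvilleConst_approx 1 le_rfl
  have : (0 : ℝ) < p / 10 ^ Nat.factorial 1 := by positivity
  linarith

/-- Eliminates q = 10^(N!) from a family of lower bounds; δ stands for a distance and H for a
height. Take the least N ≥ N₀ with T H^D ≤ q^(N-A): the error term then costs at most c/2, and
minimality keeps q ≤ K H^(2D). -/
theorem exists_le_mul_pow_of_forall_factorial (A D : ℕ) {c C : ℝ} (hc : 0 < c) (hC : 0 ≤ C) :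
    ∃ c' : ℝ, 0 < c' ∧ ∃ E : ℕ, ∀ δ H : ℝ, 0 ≤ δ → 1 ≤ H →
      (∀ N : ℕ, 1 ≤ N → c ≤ (δ + C / ((10 : ℝ) ^ N.factorial) ^ N) *
        (H ^ D * ((10 : ℝ) ^ N.factorial) ^ A)) → c' ≤ δ * H ^ E := by
  -- For N ≥ 2A + 2 one has N ≤ 2(N - 1 - A), so 10^(N!) = (10^((N-1)!))^N is at most the square of
  -- the quantity that failed the test at N - 1.
  set N₀ := 2 * A + 2 with hN₀
  set T := 2 * C / c + 1 with hT
  have hT1 : 1 ≤ T := le_add_of_nonneg_left (by positivity)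
  set K := (10 : ℝ) ^ N₀.factorial * T ^ 2 with hK
  refine ⟨c / 2 / K ^ A, by positivity, D + 2 * D * A, fun δ H hδ hH h => ?_⟩
  have hTH : 1 ≤ T * H ^ D := one_le_mul_of_one_le_of_one_le hT1 (one_le_pow₀ hH)
  have hex : ∃ N, N₀ ≤ N ∧ T * H ^ D ≤ ((10 : ℝ) ^ N.factorial) ^ (N - A) := by
    obtain ⟨n, hn⟩ := pow_unbounded_of_one_lt (T * H ^ D) (by norm_num : (1 : ℝ) < 10)
    refine ⟨max N₀ n, le_max_left _ _, hn.le.trans ?_⟩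
    rw [← pow_mul]
    refine pow_le_pow_right₀ (by norm_num) ?_
    have h1 : n ≤ (max N₀ n).factorial := (le_max_right _ _).trans (Nat.self_le_factorial _)
    have h2 : 1 ≤ max N₀ n - A := by omega
    exact h1.trans (Nat.le_mul_of_pos_right _ h2)
  classical
  obtain ⟨hN1, hN2⟩ := Nat.find_spec hex
  have hmin : ∀ n < Nat.find hex, _ := fun n hn => Nat.find_min hex hn
  set N := Nat.find hex
  set q := (10 : ℝ) ^ N.factorial with hq
  have hq1 : 1 ≤ q := one_le_pow₀ (by norm_num)
  have hqK : q ≤ K * H ^ (2 * D) := by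
    have hKH : K * H ^ (2 * D) = (10 : ℝ) ^ N₀.factorial * (T * H ^ D) ^ 2 := by
      rw [hK]; ring
    rw [hKH]
    rcases hN1.eq_or_lt with he | hlt
    · rw [hq, ← he]
      exact le_mul_of_one_le_right (by positivity) (one_le_pow₀ hTH)
    · have hnot := hmin (N - 1) (by omega)
      have hlt' : ((10 : ℝ) ^ (N - 1).factorial) ^ (N - 1 - A) < T * H ^ D := by
        by_contra hcon
        exact hnot ⟨by omega, not_lt.mp hcon⟩
      refine le_trans ?_ (le_mul_of_one_le_left (by positivity) (one_le_pow₀ (by norm_num)))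
      refine le_trans ?_ (pow_le_pow_left₀ (by positivity) hlt'.le 2)
      rw [hq, ← pow_mul, ← pow_mul, ← Nat.mul_factorial_pred (show N ≠ 0 by omega)]
      refine pow_le_pow_right₀ (by norm_num) ?_
      rw [mul_comm]
      exact Nat.mul_le_mul_left _ (by omega)
  have hmain := h N (by omega)
  have hsplit : q ^ N = q ^ (N - A) * q ^ A := by
    rw [← pow_add, Nat.sub_add_cancel (by omega)]
  have hsmall : C / q ^ N * (H ^ D * q ^ A) ≤ c / 2 := by
    rw [hsplit]
    calc C / (q ^ (N - A) * q ^ A) * (H ^ D * q ^ A) = C * H ^ D / q ^ (N - A) := by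
          field_simp
      _ ≤ c / 2 := by
        rw [div_le_iff₀ (by positivity)]
        refine le_trans ?_ (mul_le_mul_of_nonneg_left hN2 (by positivity))
        have : C ≤ c / 2 * T := by rw [hT]; field_simp; linarith
        calc C * H ^ D ≤ c / 2 * T * H ^ D := by gcongr
          _ = _ := by ring
  have hhalf : c / 2 ≤ δ * (H ^ D * q ^ A) := by
    rw [add_mul] at hmain
    linarith
  rw [div_le_iff₀ (by positivity)]
  calc c / 2 ≤ δ * (H ^ D * q ^ A) := hhalf
    _ ≤ δ * (H ^ D * (K * H ^ (2 * D)) ^ A) := by gcongr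
    _ = _ := by rw [mul_pow, ← pow_mul, pow_add]; ring

/-- Both ℓ and its truncation lie in (0, 1], where x ↦ x^k is k-Lipschitz. -/
theorem exists_liouvilleConst_pow_approx {k : ℕ} (hk : 1 ≤ k) (N : ℕ) (hN : 1 ≤ N) :
    ∃ a : ℤ, 0 < a ∧ a ≤ (10 ^ N.factorial) ^ k ∧
      0 < liouvilleConst ^ k - a / ((10 : ℝ) ^ N.factorial) ^ k ∧
      liouvilleConst ^ k - a / ((10 : ℝ) ^ N.factorial) ^ k ≤
        k / ((10 : ℝ) ^ N.factorial) ^ N := by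
  obtain ⟨p, hp0, hpq, hlt, hle⟩ := exists_liouvilleConst_approx N hN
  have hp0' : (0 : ℝ) < p := by exact_mod_cast hp0
  have hx : 0 < (p : ℝ) / 10 ^ N.factorial := by positivity
  have hx1 : (p : ℝ) / 10 ^ N.factorial ≤ 1 := by linarith [liouvilleConst_le_one]
  refine ⟨p ^ k, by positivity, pow_le_pow_left₀ hp0.le hpq k, ?_, ?_⟩
  · push_cast
    rw [← div_pow]
    exact sub_pos.mpr (pow_lt_pow_left₀ (by linarith) hx.le (by omega))
  · push_cast
    rw [← div_pow]
    refine (le_abs_self _).trans ((abs_pow_sub_pow_le _ _ _).trans ?_)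
    rw [abs_of_pos hlt, abs_of_pos liouvilleConst_pos, abs_of_pos hx]
    calc _ ≤ 1 / ((10 : ℝ) ^ N.factorial) ^ N * k * 1 := by
          refine mul_le_mul (by gcongr) (pow_le_one₀ (by positivity)
            (max_le liouvilleConst_le_one hx1)) (by positivity) (by positivity)
      _ = _ := by ring

/-- Algebraic numbers of degree less than that of `β` approximate `β * ℓ ^ k` at most polynomially
well in terms of their heights. -/
theorem exists_le_abs_mul_liouvilleConst_pow_sub {β : ℝ} (hβ : IsIntegral ℤ β) (hβ0 : 0 < β)
    {k : ℕ} (hk : 1 ≤ k) :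
    ∃ c : ℝ, 0 < c ∧ ∃ E : ℕ, ∀ α : ℝ, IsAlgebraic ℚ α →
      (minpoly ℚ α).natDegree < (minpoly ℚ β).natDegree →
      |β * liouvilleConst ^ k - α| ≤ 1 →
      c ≤ |β * liouvilleConst ^ k - α| * algHeight α ^ E := by
  set d := (minpoly ℚ β).natDegree with hd
  have hl0 := liouvilleConst_pos
  have hl1 : liouvilleConst ^ k ≤ 1 := pow_le_one₀ hl0.le liouvilleConst_le_one
  -- Since βℓ^k ≤ β, every α within distance 1 has |α| ≤ β + 1.
  obtain ⟨c, hc, hlow⟩ := exists_le_abs_mul_div_sub hβ (M := β + 1) (by linarith)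
  -- The denominator of the k-th power is q^k, and (H (q^k)^d)^d = H^d q^(kdd).
  obtain ⟨c', hc', E, hE⟩ := exists_le_mul_pow_of_forall_factorial (k * d * d) d hc
    (C := β * k) (by positivity)
  refine ⟨c', hc', E, fun α hα hn hα1 => ?_⟩
  refine hE _ _ (abs_nonneg _) (one_le_algHeight α) fun N hN => ?_
  obtain ⟨a, ha0, hab, hlt, hle⟩ := exists_liouvilleConst_pow_approx hk N hN
  have ha0' : (0 : ℝ) < a := by exact_mod_cast ha0
  have hξ : β * liouvilleConst ^ k ≤ β := mul_le_of_le_one_right hβ0.le hl1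
  have hξ0 : 0 < β * liouvilleConst ^ k := by positivity
  have h := hlow α a ((10 ^ N.factorial) ^ k) hα hn (by
    rw [abs_le] at hα1 ⊢
    constructor <;> linarith) ha0 hab (by
    push_cast
    rw [abs_of_pos (by positivity)]
    have : β * (a / ((10 : ℝ) ^ N.factorial) ^ k) ≤ β * liouvilleConst ^ k :=
      mul_le_mul_of_nonneg_left (by linarith) hβ0.le
    linarith)
  push_cast at h
  refine h.trans ?_
  have htri : |β * (a / ((10 : ℝ) ^ N.factorial) ^ k) - α| ≤
      |β * liouvilleConst ^ k - α| + β * k / ((10 : ℝ) ^ N.factorial) ^ N := by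
    have h1 : |β * (a / ((10 : ℝ) ^ N.factorial) ^ k) - β * liouvilleConst ^ k| ≤
        β * k / ((10 : ℝ) ^ N.factorial) ^ N := by
      rw [abs_sub_comm, ← mul_sub, abs_mul, abs_of_pos hβ0, abs_of_pos hlt, mul_div_assoc]
      exact mul_le_mul_of_nonneg_left hle hβ0.le
    have h2 := abs_sub_le (β * (a / ((10 : ℝ) ^ N.factorial) ^ k)) (β * liouvilleConst ^ k) α
    linarith
  have hH : 0 ≤ algHeight α := zero_le_one.trans (one_le_algHeight α)
  refine (mul_le_mul_of_nonneg_right htri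
    (pow_nonneg (mul_nonneg hH (by positivity)) _)).trans (le_of_eq ?_)
  rw [mul_pow (algHeight α), ← pow_mul, ← pow_mul, ← pow_mul, ← pow_mul, ← pow_mul, mul_assoc k d d]

/-! ### From distance estimates to ω*. -/

/-- For w > E an approximation satisfies c ≤ H^(-E-1) H^E = 1/H, so its height is bounded and
Northcott applies. Requiring |ξ - α| ≤ 1 costs nothing because H ≥ 1. -/
theorem omegaStar_lt_top_of_forall_le {n : ℕ} {ξ c : ℝ} {E : ℕ} (hc : 0 < c)
    (h : ∀ α : ℝ, IsAlgebraic ℚ α → (minpoly ℚ α).natDegree = n → |ξ - α| ≤ 1 →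
      c ≤ |ξ - α| * algHeight α ^ E) : omegaStar n ξ < ∞ := by
  refine lt_of_le_of_lt (sSup_le ?_) (ENNReal.ofReal_lt_top (r := E))
  rintro _ ⟨w, ⟨hw, hinf⟩, rfl⟩
  apply ENNReal.ofReal_le_ofReal
  by_contra! hwE
  refine hinf ((finite_algHeight_le n c⁻¹).subset ?_)
  rintro α ⟨hα, hn, -, hlt⟩
  refine ⟨hα, hn, ?_⟩
  have hH := one_le_algHeight α
  have hH0 : 0 < algHeight α := by linarith
  have hle : algHeight α ^ (-w - 1) ≤ algHeight α ^ (-(E : ℝ) - 1) :=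
    Real.rpow_le_rpow_of_exponent_le hH (by linarith)
  have hone : algHeight α ^ (-w - 1) ≤ 1 := Real.rpow_le_one_of_one_le_of_nonpos hH (by linarith)
  have hEpow : algHeight α ^ (-(E : ℝ) - 1) * algHeight α ^ E = (algHeight α)⁻¹ := by
    rw [← Real.rpow_natCast, ← Real.rpow_add hH0, ← Real.rpow_neg_one]
    congr 1
    ring
  have := calc c ≤ _ := h α hα hn (hlt.le.trans hone)
    _ ≤ algHeight α ^ (-(E : ℝ) - 1) * algHeight α ^ E :=
      mul_le_mul_of_nonneg_right (hlt.le.trans hle) (by positivity)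
    _ = _ := hEpow
  exact (le_inv_comm₀ hc hH0).mp this

theorem omegaStar_eq_top_of_forall_infinite {n : ℕ} {ξ : ℝ}
    (h : ∀ W : ℕ, 1 ≤ W → (algApprox n ξ W).Infinite) : omegaStar n ξ = ∞ := by
  refine sSup_eq_top.mpr fun b hb => ?_
  obtain ⟨W, hW⟩ := ENNReal.exists_nat_gt hb.ne
  refine ⟨_, ⟨(W + 1 : ℕ), ⟨by positivity, h _ (by omega)⟩, rfl⟩, ?_⟩
  rw [ENNReal.ofReal_natCast]
  refine hW.trans_le ?_
  exact_mod_cast Nat.le_succ W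

open Filter Topology in
theorem infinite_algApprox_mul_liouvilleConst_pow {β : ℝ} (hβ : IsAlgebraic ℚ β) (hβ0 : 0 < β)
    {k : ℕ} (hk : 1 ≤ k) (W : ℕ) :
    (algApprox (minpoly ℚ β).natDegree (β * liouvilleConst ^ k) W).Infinite := by
  set d := (minpoly ℚ β).natDegree with hd
  intro hfin
  choose a ha0 hab hlt hle using fun N : ℕ =>
    exists_liouvilleConst_pow_approx hk (N + 1) (by omega)
  set q : ℕ → ℝ := fun N => 10 ^ (N + 1).factorial with hq
  have hq0 (N : ℕ) : 0 < q N := by positivity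
  have hq1 (N : ℕ) : 1 ≤ q N := one_le_pow₀ (by norm_num)
  have hqN (N : ℕ) : (10 : ℝ) ^ N ≤ q N :=
    pow_le_pow_right₀ (by norm_num) ((Nat.le_succ N).trans (Nat.self_le_factorial _))
  have hqtop : Tendsto q atTop atTop :=
    tendsto_atTop_mono hqN (tendsto_pow_atTop_atTop_of_one_lt (by norm_num))
  let α : ℕ → ℝ := fun N => β * (a N / q N ^ k)
  have hαpos (N : ℕ) : 0 < β * liouvilleConst ^ k - α N := by
    simp only [α, ← mul_sub]
    exact mul_pos hβ0 (hlt N)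
  have hαle (N : ℕ) : β * liouvilleConst ^ k - α N ≤ β * k / q N ^ (N + 1) := by
    simp only [α, ← mul_sub]
    rw [mul_div_assoc]
    exact mul_le_mul_of_nonneg_left (hle N) hβ0.le
  have hlim : Tendsto α atTop (𝓝 (β * liouvilleConst ^ k)) := by
    have h0 : Tendsto (fun N => β * k / q N) atTop (𝓝 0) := hqtop.const_div_atTop _
    have h1 := squeeze_zero (fun N => (hαpos N).le) (fun N => (hαle N).trans
      (div_le_div_of_nonneg_left (by positivity) (hq0 N) (le_self_pow₀ (hq1 N) N.succ_ne_zero))) h0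
    simpa using tendsto_const_nhds (x := β * liouvilleConst ^ k).sub h1
  have hH0 := one_le_algHeight β
  have hmem : ∀ᶠ N in atTop, α N ∈ algApprox d (β * liouvilleConst ^ k) W := by
    -- One factor q absorbs the constants; the second condition fits the exponent kd(W + 1) + 1
    -- under N + 1.
    filter_upwards [hqtop.eventually_gt_atTop (β * k * algHeight β ^ (W + 1)),
      eventually_ge_atTop (k * d * (W + 1))] with N hN1 hN2
    have ha0' : (0 : ℝ) < a N := by exact_mod_cast ha0 N
    have hαeq : α N = β * ((a N / ((10 ^ (N + 1).factorial) ^ k : ℤ) : ℚ) : ℚ) := by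
      simp [α, hq]
    have hrat : ((a N / ((10 ^ (N + 1).factorial) ^ k : ℤ) : ℚ) : ℚ) ≠ 0 := by
      have : (0 : ℚ) < a N := by exact_mod_cast ha0 N
      positivity
    refine ⟨?_, ?_, abs_pos.mpr (hαpos N).ne', ?_⟩
    · rw [hαeq]
      exact hβ.mul (isAlgebraic_algebraMap (R := ℚ) _)
    · rw [hαeq, natDegree_minpoly_mul_ratCast hβ.isIntegral hrat]
    · have hheight : algHeight (α N) ≤ algHeight β * (q N ^ k) ^ d := by
        have := algHeight_mul_div_le hβ (ha0 N) (hab N)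
        push_cast at this
        exact this
      have hHα := one_le_algHeight (α N)
      have hHα0 : 0 < algHeight (α N) := by linarith
      rw [abs_of_pos (hαpos N), show (-(W : ℝ) - 1) = -((W + 1 : ℕ) : ℝ) by push_cast; ring,
        Real.rpow_neg hHα0.le, Real.rpow_natCast]
      refine (hαle N).trans_lt ?_
      rw [← one_div, div_lt_div_iff₀ (pow_pos (hq0 N) _) (pow_pos hHα0 _), one_mul]
      calc β * k * algHeight (α N) ^ (W + 1)
          ≤ β * k * (algHeight β * (q N ^ k) ^ d) ^ (W + 1) := by gcongr
        _ = β * k * algHeight β ^ (W + 1) * q N ^ (k * d * (W + 1)) := by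
          rw [mul_pow, ← pow_mul, ← pow_mul, mul_assoc (β * k), mul_assoc k d]
        _ < q N * q N ^ (k * d * (W + 1)) :=
          mul_lt_mul_of_pos_right hN1 (pow_pos (hq0 N) _)
        _ = q N ^ (k * d * (W + 1) + 1) := by rw [pow_succ, mul_comm]
        _ ≤ q N ^ (N + 1) := pow_le_pow_right₀ (hq1 N) (by omega)
  -- A finite set is closed, so it would contain the limit βℓ^k, which 0 < |ξ - α| excludes.
  -- Distinctness of the approximations is never needed.
  have := hfin.isClosed.mem_of_tendsto hlim hmem
  simpa using this.2.2.1

theorem isUNumber_mul_liouvilleConst_pow {β : ℝ} (hβ : IsIntegral ℤ β) (hβ0 : 0 < β)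
    {k : ℕ} (hk : 1 ≤ k) :
    IsUNumber (minpoly ℚ β).natDegree (β * liouvilleConst ^ k) := by
  have hβQ : IsIntegral ℚ β := hβ.tower_top
  refine ⟨minpoly.natDegree_pos hβQ, omegaStar_eq_top_of_forall_infinite fun W _ =>
    infinite_algApprox_mul_liouvilleConst_pow hβQ.isAlgebraic hβ0 hk W, fun n _ hn => ?_⟩
  obtain ⟨c, hc, E, h⟩ := exists_le_abs_mul_liouvilleConst_pow_sub hβ hβ0 hk
  exact omegaStar_lt_top_of_forall_le hc fun α hα hαn hα1 => h α hα (hαn ▸ hn) hα1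

/-! ### Degrees of p^(1/m) and of the powers of 1 + p^(1/m). -/

theorem irreducible_X_pow_sub_C_natCast_prime {p : ℕ} (hp : p.Prime) {m : ℕ} (hm : 1 ≤ m) :
    Irreducible (X ^ m - C (p : ℤ)) := by
  have hp' : Prime (p : ℤ) := Nat.prime_iff_prime_int.mp hp
  have hmonic : (X ^ m - C (p : ℤ)).Monic := monic_X_pow_sub_C _ (by omega)
  refine irreducible_of_eisenstein_criterion (P := Ideal.span {(p : ℤ)})
    ((Ideal.span_singleton_prime hp'.ne_zero).mpr hp') ?_ ?_ ?_ ?_ hmonic.isPrimitive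
  · rw [hmonic.leadingCoeff, Ideal.mem_span_singleton]
    exact fun h => hp'.not_isUnit (isUnit_of_dvd_one h)
  · intro n hn
    rw [degree_X_pow_sub_C (by omega)] at hn
    have hn' : n < m := by exact_mod_cast hn
    rw [coeff_sub, coeff_X_pow, if_neg hn'.ne, coeff_C, Ideal.mem_span_singleton]
    split_ifs <;> simp
  · rw [degree_X_pow_sub_C (by omega)]
    exact_mod_cast hm
  · rw [Ideal.span_singleton_pow, Ideal.mem_span_singleton, coeff_sub, coeff_X_pow,
      if_neg (by omega), coeff_C_zero, zero_sub, dvd_neg, pow_two]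
    intro h
    have h2 : (p : ℤ) * p ∣ p * 1 := by simpa using h
    exact hp'.not_isUnit (isUnit_of_dvd_one (Int.dvd_of_mul_dvd_mul_left hp'.ne_zero h2))

theorem rpow_one_div_natCast_pow {x : ℝ} (hx : 0 ≤ x) {m : ℕ} (hm : 1 ≤ m) :
    (x ^ (1 / (m : ℝ))) ^ m = x := by
  rw [one_div, Real.rpow_inv_natCast_pow hx (by omega)]

theorem isIntegral_rpow_one_div (p : ℕ) {m : ℕ} (hm : 1 ≤ m) :
    IsIntegral ℤ ((p : ℝ) ^ (1 / (m : ℝ))) := by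
  refine IsIntegral.of_pow hm ?_
  rw [rpow_one_div_natCast_pow p.cast_nonneg hm]
  exact isIntegral_algebraMap (R := ℤ) (x := (p : ℤ))

theorem natDegree_minpoly_rpow_one_div {p : ℕ} (hp : p.Prime) {m : ℕ} (hm : 1 ≤ m) :
    (minpoly ℚ ((p : ℝ) ^ (1 / (m : ℝ)))).natDegree = m := by
  have hmonic : (X ^ m - C (p : ℤ)).Monic := monic_X_pow_sub_C _ (by omega)
  have hirr := (hmonic.irreducible_iff_irreducible_map_fraction_map (K := ℚ)).mp
    (irreducible_X_pow_sub_C_natCast_prime hp hm)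
  rw [← minpoly.eq_of_irreducible_of_monic hirr _ (hmonic.map _), hmonic.natDegree_map,
    natDegree_X_pow_sub_C]
  rw [aeval_map_algebraMap]
  simp only [map_sub, map_pow, aeval_X, aeval_C]
  rw [rpow_one_div_natCast_pow p.cast_nonneg hm]
  simp

/-- The circles of radius a about 0 and 1 + a about -1 are internally tangent and meet only at a. -/
theorem Complex.eq_ofReal_of_norm_one_add {z : ℂ} {a : ℝ} (hz : ‖z‖ = a) (hz1 : ‖1 + z‖ = 1 + a) :
    z = a := by
  have h1 : z.re * z.re + z.im * z.im = a ^ 2 := by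
    rw [← hz, Complex.sq_norm, Complex.normSq_apply]
  have h2 : (1 + z.re) * (1 + z.re) + z.im * z.im = (1 + a) ^ 2 := by
    rw [← hz1, Complex.sq_norm, Complex.normSq_apply]
    simp
  have hre : z.re = a := by linarith
  rw [hre] at h1
  have him : z.im = 0 := by
    have : z.im * z.im = 0 := by linarith
    simpa using this
  exact Complex.ext (by simpa using hre) (by simpa using him)

open IntermediateField in
/-- If `a > 0` has a rational power, all powers of `1 + a` generate `ℚ(a)`. -/
theorem adjoin_one_add_pow_eq {a : ℝ} (ha : 0 < a) {m : ℕ} (hm : 1 ≤ m) {r : ℚ}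
    (har : a ^ m = r) {k : ℕ} (hk : 1 ≤ k) : ℚ⟮(1 + a) ^ k⟯ = ℚ⟮a⟯ := by
  classical
  have hmemr (K : IntermediateField ℚ ℝ) : (r : ℝ) ∈ K := K.algebraMap_mem r
  apply le_antisymm
  · exact adjoin_simple_le_iff.mpr
      (pow_mem (add_mem (one_mem _) (mem_adjoin_simple_self ℚ a)) k)
  rw [adjoin_simple_le_iff]
  set L := ℚ⟮(1 + a) ^ k⟯ with hL
  let g : L := ⟨(1 + a) ^ k, mem_adjoin_simple_self ℚ _⟩
  let s : L := ⟨r, hmemr L⟩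
  have hroot₁ : aeval a (X ^ m - C s) = 0 := by
    simp only [map_sub, map_pow, aeval_X, aeval_C, har]
    exact sub_self _
  have hroot₂ : aeval a ((1 + X) ^ k - C g) = 0 := by
    simp only [map_sub, map_pow, map_add, map_one, aeval_X, aeval_C]
    exact sub_self _
  have haint : IsIntegral L a :=
    ⟨X ^ m - C s, monic_X_pow_sub_C _ (by omega), hroot₁⟩
  let φ : L →+* ℂ := Complex.ofRealHom.comp (algebraMap L ℝ)
  -- A conjugate z of a over L satisfies z^m = a^m and (1 + z)^k = (1 + a)^k; absolute values put it
  -- on both circles.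
  have hroots : ∀ z ∈ ((minpoly L a).map φ).roots, z = (a : ℂ) := by
    intro z hz
    have hz0 : eval₂ φ z (minpoly L a) = 0 := by
      rw [← eval_map]
      exact isRoot_of_mem_roots hz
    have h1 := eval₂_eq_zero_of_dvd_of_eval₂_eq_zero φ z (minpoly.dvd L a hroot₁) hz0
    have h2 := eval₂_eq_zero_of_dvd_of_eval₂_eq_zero φ z (minpoly.dvd L a hroot₂) hz0
    simp only [eval₂_sub, eval₂_pow, eval₂_X, eval₂_C, eval₂_add, eval₂_one, sub_eq_zero] at h1 h2
    have hs : φ s = ((a ^ m : ℝ) : ℂ) := by rw [har]; rfl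
    have hg : φ g = (((1 + a) ^ k : ℝ) : ℂ) := rfl
    rw [hs] at h1
    rw [hg] at h2
    apply Complex.eq_ofReal_of_norm_one_add
    · have := congrArg norm h1
      rw [norm_pow, Complex.norm_real, Real.norm_of_nonneg (by positivity)] at this
      exact (pow_left_inj₀ (norm_nonneg _) ha.le (by omega)).mp this
    · have := congrArg norm h2
      rw [norm_pow, Complex.norm_real, Real.norm_of_nonneg (by positivity)] at this
      exact (pow_left_inj₀ (norm_nonneg _) (by positivity) (by omega)).mp this
  have hnodup : ((minpoly L a).map φ).roots.Nodup :=
    nodup_roots (minpoly.irreducible haint).separable.map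
  -- The roots are distinct by separability, yet all equal a; hence a has degree 1 over L.
  have hdeg : (minpoly L a).natDegree ≤ 1 := by
    rw [← natDegree_map φ, (IsAlgClosed.splits _).natDegree_eq_card_roots,
      Multiset.eq_replicate_card.mpr hroots, Multiset.card_replicate]
    exact (Multiset.nodup_iff_count_le_one.mp hnodup a).trans' (by
      rw [Multiset.eq_replicate_card.mpr hroots]; simp)
  obtain ⟨x, hx⟩ := minpoly.natDegree_eq_one_iff.mp
    (le_antisymm hdeg (minpoly.natDegree_pos haint))
  rw [← hx]
  exact x.2

open IntermediateField in
theorem natDegree_minpoly_one_add_rpow_pow {p : ℕ} (hp : p.Prime) {m : ℕ} (hm : 1 ≤ m) {k : ℕ}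
    (hk : 1 ≤ k) : (minpoly ℚ ((1 + (p : ℝ) ^ (1 / (m : ℝ))) ^ k)).natDegree = m := by
  have hp0 : (0 : ℝ) < p := by exact_mod_cast hp.pos
  have ha : IsIntegral ℚ ((p : ℝ) ^ (1 / (m : ℝ))) := (isIntegral_rpow_one_div p hm).tower_top
  have hint : IsIntegral ℚ ((1 + (p : ℝ) ^ (1 / (m : ℝ))) ^ k) := (isIntegral_one.add ha).pow k
  rw [← adjoin.finrank hint, adjoin_one_add_pow_eq (Real.rpow_pos_of_pos hp0 _) hm (r := p)
    (by simpa using rpow_one_div_natCast_pow p.cast_nonneg hm) hk, adjoin.finrank ha,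
    natDegree_minpoly_rpow_one_div hp hm]

/-! ### The two families. -/

theorem isUNumber_rpow_mul_liouvilleConst {p : ℕ} (hp : p.Prime) {m : ℕ} (hm : 1 ≤ m) {k : ℕ}
    (hk : 1 ≤ k) : IsUNumber m ((p : ℝ) ^ (1 / (m : ℝ)) * liouvilleConst ^ k) := by
  have hp0 : (0 : ℝ) < p := by exact_mod_cast hp.pos
  have := isUNumber_mul_liouvilleConst_pow (isIntegral_rpow_one_div p hm)
    (Real.rpow_pos_of_pos hp0 _) hk
  rwa [natDegree_minpoly_rpow_one_div hp hm] at this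

theorem exists_isUNumber_pow_of_dvd {p : ℕ} (hp : p.Prime) {m : ℕ} (hm : 1 ≤ m) {d : ℕ}
    (hd : d ∣ m) :
    ∃ k : ℕ, 1 ≤ k ∧ IsUNumber d (((p : ℝ) ^ (1 / (m : ℝ)) * liouvilleConst) ^ k) := by
  obtain ⟨k, rfl⟩ := hd
  have hd1 : 1 ≤ d := Nat.pos_of_mul_pos_right hm
  have hk1 : 1 ≤ k := Nat.pos_of_mul_pos_left hm
  have hk0 : (k : ℝ) ≠ 0 := by positivity
  refine ⟨k, hk1, ?_⟩
  have hpow : ((p : ℝ) ^ (1 / ((d * k : ℕ) : ℝ))) ^ k = (p : ℝ) ^ (1 / (d : ℝ)) := by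
    rw [← Real.rpow_mul_natCast p.cast_nonneg]
    congr 1
    push_cast
    field_simp
  rw [mul_pow, hpow]
  exact isUNumber_rpow_mul_liouvilleConst hp hd1 hk1

theorem isUNumber_one_add_rpow_mul_liouvilleConst_pow {p : ℕ} (hp : p.Prime) {m : ℕ} (hm : 1 ≤ m)
    {k : ℕ} (hk : 1 ≤ k) :
    IsUNumber m (((1 + (p : ℝ) ^ (1 / (m : ℝ))) * liouvilleConst) ^ k) := by
  have hp0 : (0 : ℝ) < p := by exact_mod_cast hp.pos
  have h := isUNumber_mul_liouvilleConst_pow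
    ((isIntegral_one.add (isIntegral_rpow_one_div p hm)).pow k) (by positivity) hk
  rwa [natDegree_minpoly_one_add_rpow_pow hp hm hk, ← mul_pow] at h

theorem rpow_one_div_natCast_injective {m : ℕ} (hm : 1 ≤ m) :
    Function.Injective fun p : ℕ => (p : ℝ) ^ (1 / (m : ℝ)) := by
  intro p q h
  have := congrArg (· ^ m) h
  simp only [rpow_one_div_natCast_pow (Nat.cast_nonneg _) hm] at this
  exact_mod_cast this

theorem corollary2 (m : ℕ) (hm : 1 ≤ m) :
    ({ξ : ℝ | IsUNumber m ξ ∧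
        ∀ d : ℕ, d ∣ m → ∃ k : ℕ, 1 ≤ k ∧ IsUNumber d (ξ ^ k)}.Infinite ∧
      ∀ p : ℕ, p.Prime →
        (p : ℝ) ^ (1 / (m : ℝ)) * liouvilleConst ∈
          {ξ : ℝ | IsUNumber m ξ ∧
            ∀ d : ℕ, d ∣ m → ∃ k : ℕ, 1 ≤ k ∧ IsUNumber d (ξ ^ k)}) ∧
    ({ξ : ℝ | IsUNumber m ξ ∧ ∀ k : ℕ, 1 ≤ k → IsUNumber m (ξ ^ k)}.Infinite ∧
      ∀ p : ℕ, p.Prime →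
        (1 + (p : ℝ) ^ (1 / (m : ℝ))) * liouvilleConst ∈
          {ξ : ℝ | IsUNumber m ξ ∧ ∀ k : ℕ, 1 ≤ k → IsUNumber m (ξ ^ k)}) := by
  have h₁ (p : ℕ) (hp : p.Prime) : (p : ℝ) ^ (1 / (m : ℝ)) * liouvilleConst ∈
      {ξ : ℝ | IsUNumber m ξ ∧ ∀ d : ℕ, d ∣ m → ∃ k : ℕ, 1 ≤ k ∧ IsUNumber d (ξ ^ k)} :=
    ⟨by simpa using isUNumber_rpow_mul_liouvilleConst hp hm le_rfl,
      fun d hd => exists_isUNumber_pow_of_dvd hp hm hd⟩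
  have h₂ (p : ℕ) (hp : p.Prime) : (1 + (p : ℝ) ^ (1 / (m : ℝ))) * liouvilleConst ∈
      {ξ : ℝ | IsUNumber m ξ ∧ ∀ k : ℕ, 1 ≤ k → IsUNumber m (ξ ^ k)} :=
    ⟨by simpa using isUNumber_one_add_rpow_mul_liouvilleConst_pow hp hm le_rfl,
      fun k hk => isUNumber_one_add_rpow_mul_liouvilleConst_pow hp hm hk⟩
  have hl := liouvilleConst_pos.ne'
  refine ⟨⟨?_, h₁⟩, ?_, h₂⟩
  · refine Set.infinite_of_injOn_mapsTo (fun p _ q _ h => ?_) h₁ Nat.infinite_setOfPred_prime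
    exact rpow_one_div_natCast_injective hm (mul_right_cancel₀ hl h)
  · refine Set.infinite_of_injOn_mapsTo (fun p _ q _ h => ?_) h₂ Nat.infinite_setOfPred_prime
    exact rpow_one_div_natCast_injective hm (add_left_cancel (mul_right_cancel₀ hl h))
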